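/- Let $d\ge 1$ and $T$ be integers with $T\ge d/4$, and let $D,B>0$. For a nonempty compact convex set $\mathcal X\subseteq\mathbb R^d$, let $\mathcal O_{c,2}(\mathcal X)$ be the set of pairs $(f,O)$ where $f:\mathcal X\to\mathbb R$ is convex and $O$ is a stochastic first-order oracle which, queried at $x\in\mathcal X$, returns (independently of the past given $x$) a random vector $\hat g(x)$ with $\mathbb E[\hat g(x)\mid x]\in\partial f(x)=\{g:\ f(y)\ge f(x)+\langle g,y-x\rangle\ \forall y\in\mathcal X\}$ and $\|\hat g(x)\|_2^2\le B^2$ almost surely. An oblivious sampling channel is given by a probability vector $(p_i)_{i\in[d]}$: on input $g\in\mathbb R^d$ it outputs $g(i)e_i$ with probability $p_i$, where $i$ is drawn independently of $g$; let $\mathcal W_{\rm obl}$ be the set of these channels. A (possibly randomized) algorithm $\pi$ with $T$ queries, together with an adaptive channel selection strategy $S$, proceeds in rounds $t=1,\dots,T$: based on a random seed and the previous outputs $Y_1,\dots,Y_{t-1}$, it chooses a query point $x_t\in\mathcal X$ and a channel $W_t\in\mathcal W_{\rm obl}$, and then observes the output $Y_t$ of $W_t$ on the input $\hat g(x_t)$.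 After round $T$ it outputs a point $\hat x\in\mathcal X$ depending on the seed and $Y_1,\dots,Y_T$. Let $$\mathcal E^*(\mathcal X,\mathcal O_{c,2},T,\mathcal W_{\rm obl})=\inf_{\pi}\inf_{S}\ \sup_{(f,O)\in\mathcal O_{c,2}(\mathcal X)}\mathbb E\Big[f(\hat x)-\min_{x\in\mathcal X}f(x)\Big].$$ Then $$\sup_{\mathcal X:\ \max_{x,y\in\mathcal X}\|x-y\|_2\le D}\ \mathcal E^*(\mathcal X,\mathcal O_{c,2},T,\mathcal W_{\rm obl})\ \ge\ \frac{1}{72}\cdot\frac{\sqrt d\,DB}{\sqrt T},$$ where the supremum is over nonempty compact convex sets $\mathcal X\subseteq\mathbb R^d$. Moreover, uniform random coordinate descent matches this bound up to a constant factor: for every such $\mathcal X$ and every starting point $x_1\in\mathcal X$, the algorithm which in every round uses the uniform channel $p_i=1/d$, updates $x_{t+1}=\mathrm{proj}_{\mathcal X}(x_t-\alpha Y_t)$ with $\alpha=\sqrt d\,D/(B\sqrt T)$, and outputs $\hat x=\frac1T\sum_{t=1}^T x_t$, satisfies $\mathbb E[f(\hat x)-\min_{\mathcal X}f]\le \sqrt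 d\,DB/\sqrt T$ for all $(f,O)\in\mathcal O_{c,2}(\mathcal X)$. -/

import Mathlib

open MeasureTheory ProbabilityTheory
open scoped ENNReal RealInnerProductSpace

noncomputable section

namespace InfoOpt

/-- `ℝ^d` with the Euclidean (`ℓ₂`) norm. -/
abbrev Vec (d : ℕ) : Type := EuclideanSpace ℝ (Fin d)

/-- A sequence of `t` channel outputs `(Y_0, …, Y_{t-1})`. -/
abbrev Hist (d t : ℕ) : Type := Fin t → Vec d

/-- The domains: nonempty compact convex sets of `ℓ₂`-diameter at most `D`. -/
def Domains (d : ℕ) (D : ℝ) : Set (Set (Vec d)) :=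
  {X | X.Nonempty ∧ Convex ℝ X ∧ IsCompact X ∧ ∀ x ∈ X, ∀ y ∈ X, ‖x - y‖ ≤ D}

/-! ### Functions and oracles -/

/-- Subgradients at `x` of `f`, regarded as a function on the domain `X`. -/
def subgradients {d : ℕ} (X : Set (Vec d)) (f : Vec d → ℝ) (x : Vec d) : Set (Vec d) :=
  {g | ∀ y ∈ X, f x + ⟪g, y - x⟫ ≤ f y}

/-- The convex and `ℓ₂`-Lipschitz family. An oracle is a Markov kernel from `X` to `ℝ^d`:
given a query point `x ∈ X` it returns a random vector `ĝ(x)`, which has to be an unbiased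
subgradient estimate with `‖ĝ(x)‖² ≤ B²` almost surely. Only the values of `f` on `X` matter. -/
def ConvexLipschitz {d : ℕ} (X : Set (Vec d)) (B : ℝ) :
    Set ((Vec d → ℝ) × Kernel X (Vec d)) :=
  {fO | ConvexOn ℝ X fO.1 ∧ IsMarkovKernel fO.2 ∧
    (∀ x : X, ∫ g, g ∂(fO.2 x) ∈ subgradients X fO.1 x) ∧
    (∀ x : X, ∀ᵐ g ∂(fO.2 x), ‖g‖ ^ 2 ≤ B ^ 2)}

/-! ### Channels -/

/-- The channel that, independently of its input `g`, draws a coordinate `i` with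
probability `p i` and outputs `g(i) e_i`. -/
def coordSampling {d : ℕ} (p : Fin d → ℝ) : Kernel (Vec d) (Vec d) where
  toFun g := ∑ i, ENNReal.ofReal (p i) • Measure.dirac (EuclideanSpace.single i (g i))
  measurable' := by
    refine Measure.measurable_of_measurable_coe _ fun s hs => ?_
    simp only [Measure.coe_finsetSum, Measure.coe_smul, Finset.sum_apply, Pi.smul_apply,
      smul_eq_mul]
    refine Finset.measurable_sum _ fun i _ => Measurable.const_mul ?_ _
    have hm : Measurable fun g : Vec d => (EuclideanSpace.single i (g i) : Vec d) := by
      have hc : Continuous fun g : Vec d => (EuclideanSpace.single i (g i) : Vec d) := by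
        have h : (fun g : Vec d => (EuclideanSpace.single i (g i) : Vec d)) =
            fun g => g i • (EuclideanSpace.single i (1 : ℝ) : Vec d) := by
          funext g; ext j; simp
        rw [h]; fun_prop
      exact hc.measurable
    exact (Measure.measurable_coe hs).comp (Measure.measurable_dirac.comp hm)

/-- The family of oblivious sampling channels. -/
def obliviousChannels (d : ℕ) : Set (Kernel (Vec d) (Vec d)) :=
  {W | ∃ p ∈ stdSimplex ℝ (Fin d), W = coordSampling p}

/-- The channel that samples a uniformly random coordinate. -/
def uniformSampling (d : ℕ) : Kernel (Vec d) (Vec d) := coordSampling fun _ => 1 / (d : ℝ)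

theorem uniformSampling_mem {d : ℕ} (hd : 1 ≤ d) : uniformSampling d ∈ obliviousChannels d := by
  refine ⟨_, ⟨fun _ => by positivity, ?_⟩, rfl⟩
  have : (d : ℝ) ≠ 0 := by positivity
  simp [this]

/-! ### Algorithms, channel selection strategies, and the optimization error -/

/-- A (possibly randomized) first-order algorithm on the domain `X` with `T` oracle queries.
The random seed is drawn once. The `t`-th query point depends on the seed and on the
channel outputs `Y_0, …, Y_{t-1}` (only rounds `t < T` are used), and the final
point depends on the seed and on all of `Y_0, …, Y_{T-1}`. -/
structure Algorithm {d : ℕ} (X : Set (Vec d)) (T : ℕ) where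
  Seed : Type
  [seedSpace : MeasurableSpace Seed]
  seedLaw : Measure Seed
  [seedProb : IsProbabilityMeasure seedLaw]
  query : (t : ℕ) → Seed × Hist d t → X
  measurable_query : ∀ t, Measurable (query t)
  output : Seed × Hist d T → X
  measurable_output : Measurable output

attribute [instance] Algorithm.seedSpace Algorithm.seedProb

/-- An adaptive channel selection strategy: the channel of round `t` is a member of `𝒲`
chosen as a function of the seed shared with the algorithm and of `Y_0, …, Y_{t-1}`. -/
structure ChannelStrategy {d : ℕ} (𝒲 : Set (Kernel (Vec d) (Vec d)))
    (Ω : Type) [MeasurableSpace Ω] where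
  channel : (t : ℕ) → Ω → Hist d t → Kernel (Vec d) (Vec d)
  mem : ∀ t ω y, channel t ω y ∈ 𝒲
  measurable_channel : ∀ t,
    Measurable fun q : (Ω × Hist d t) × Vec d => channel t q.1.1 q.1.2 q.2

/-- The strategy as a kernel from (seed, past outputs, oracle answer) to the new output. -/
def ChannelStrategy.kernel {d : ℕ} {𝒲 : Set (Kernel (Vec d) (Vec d))} {Ω : Type}
    [MeasurableSpace Ω] (S : ChannelStrategy 𝒲 Ω) (t : ℕ) :
    Kernel ((Ω × Hist d t) × Vec d) (Vec d) where
  toFun q := S.channel t q.1.1 q.1.2 q.2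
  measurable' := S.measurable_channel t

/-- The nonadaptive strategy that uses the same channel `W ∈ 𝒲` in every round. -/
def ChannelStrategy.const {d : ℕ} {𝒲 : Set (Kernel (Vec d) (Vec d))} {Ω : Type}
    [MeasurableSpace Ω] {W : Kernel (Vec d) (Vec d)} (hW : W ∈ 𝒲) : ChannelStrategy 𝒲 Ω where
  channel _ _ _ := W
  mem _ _ _ := hW
  measurable_channel _ := W.measurable.comp measurable_snd

variable {d : ℕ} {X : Set (Vec d)} {T : ℕ}

/-- The conditional law of `Y_t` given the seed and `Y_0, …, Y_{t-1}`: the oracle `O` is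
queried at `x_t` and its answer `ĝ(x_t)` is passed through the selected channel. -/
def stepKernel (O : Kernel X (Vec d)) (π : Algorithm X T) {𝒲 : Set (Kernel (Vec d) (Vec d))}
    (S : ChannelStrategy 𝒲 π.Seed) (t : ℕ) : Kernel (π.Seed × Hist d t) (Vec d) :=
  ((O.comap (π.query t) (π.measurable_query t)) ⊗ₖ S.kernel t).snd

/-- The conditional law of `(Y_0, …, Y_{t-1})` given the seed. -/
def transcript (O : Kernel X (Vec d)) (π : Algorithm X T) {𝒲 : Set (Kernel (Vec d) (Vec d))}
    (S : ChannelStrategy 𝒲 π.Seed) : (t : ℕ) → Kernel π.Seed (Hist d t)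
  | 0 => Kernel.const _ (Measure.dirac Fin.elim0)
  | t + 1 => (transcript O π S t ⊗ₖ stepKernel O π S t).map
      fun q => Fin.snoc (α := fun _ => Vec d) q.1 q.2

/-- The expected optimality gap `𝔼[f(x̂) - min_X f]` of the output `x̂` after `T` queries. -/
def error (f : Vec d → ℝ) (O : Kernel X (Vec d)) (π : Algorithm X T)
    {𝒲 : Set (Kernel (Vec d) (Vec d))} (S : ChannelStrategy 𝒲 π.Seed) : ℝ≥0∞ :=
  ∫⁻ z, ENNReal.ofReal (f (π.output z) - ⨅ x : X, f x) ∂(π.seedLaw ⊗ₘ transcript O π S T)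

/-- The largest error of `(π, S)` over a class `𝒪` of pairs of functions and oracles. -/
def worstError (𝒪 : Set ((Vec d → ℝ) × Kernel X (Vec d))) (π : Algorithm X T)
    {𝒲 : Set (Kernel (Vec d) (Vec d))} (S : ChannelStrategy 𝒲 π.Seed) : ℝ≥0∞ :=
  ⨆ fO ∈ 𝒪, error fO.1 fO.2 π S

/-- The adaptive minmax optimization error. -/
def minmaxError (X : Set (Vec d)) (𝒪 : Set ((Vec d → ℝ) × Kernel X (Vec d))) (T : ℕ)
    (𝒲 : Set (Kernel (Vec d) (Vec d))) : ℝ≥0∞ :=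
  ⨅ π : Algorithm X T, ⨅ S : ChannelStrategy 𝒲 π.Seed, worstError 𝒪 π S

/-! ### Random coordinate descent -/

/-- `π` is (projected) coordinate descent started at `x₀` with step size `α`: it moves by
`-α Y_t`, where `Y_t` is the observed coordinate of the subgradient estimate, takes the
nearest point of `X`, and finally outputs the average of its `T` query points. -/
def IsCoordinateDescent (π : Algorithm X T) (x₀ : X) (α : ℝ) : Prop :=
  (∀ ω y, π.query 0 (ω, y) = x₀) ∧
  (∀ t ω (y : Hist d (t + 1)), ∀ z ∈ X,
    ‖(π.query (t + 1) (ω, y) : Vec d) -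
        ((π.query t (ω, fun i => y i.castSucc) : Vec d) - α • y (Fin.last t))‖ ≤
      ‖z - ((π.query t (ω, fun i => y i.castSucc) : Vec d) - α • y (Fin.last t))‖) ∧
  (∀ ω (y : Hist d T), (π.output (ω, y) : Vec d) =
    (1 / (T : ℝ)) • ∑ t : Fin T, (π.query t (ω, fun i => y (Fin.castLE t.isLt.le i)) : Vec d))

end InfoOpt

end

open InfoOpt

/-! Lower bound. On the cube `[-b, b]^d` take the linear functions `⟪κ s u, x⟫`, with `u` one of the
`2^d` sign vectors, and an oracle answering `s u` or `-s u` with mean `κ s u`. An oblivious channel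
draws its coordinate `j` without seeing the answer, so each round shows one coin of bias `κ u_j` and
nothing about the other signs.

Write every transcript law as a density against the transcript of fair coins
(`lintegral_transcript_signOracle`), and sum the affinities `√(L L')` over all pairs of sign vectors
differing in one place. Showing coordinate `j` hurts only the pairs that differ at `j`, and those by
a factor `√(1 - κ²)`. So the total affinity, initially `2^d d`, drops by at most `κ² 2^d` in
expectation per round, however the channels adapt (`affinity_le_sum_snoc`, `le_lintegral_affinity`).
While `T κ² ≤ d / 16` neighbouring hypotheses remain confusable on average. `two_mul_affinity_le`
turns this into a lower bound for the error averaged over sign vectors, hence for the worst error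
(`le_worstError_cube`).

Upper bound. Given `g`, a uniformly sampled coordinate has mean `g / d` and second moment `‖g‖² /
d`. The usual potential, squared distance to a minimizer plus `2α/d` times the accumulated gaps,
therefore grows by at most `α² B² / d` in expectation per round
(`lintegral_descentPotential_snoc_le`). Jensen's inequality passes from the query points to their
average. -/

namespace InfoOpt

/-! ### Integration against channels, steps and transcripts. -/

section Kernels

variable {d : ℕ}

theorem continuous_single (i : Fin d) :
    Continuous fun a : ℝ => (EuclideanSpace.single i a : Vec d) := by
  have h : (fun a : ℝ => (EuclideanSpace.single i a : Vec d)) =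
      fun a => a • (EuclideanSpace.single i (1 : ℝ) : Vec d) := by
    funext g; ext j; simp
  rw [h]; fun_prop

theorem lintegral_coordSampling (p : Fin d → ℝ) (g : Vec d) {F : Vec d → ℝ≥0∞}
    (hF : Measurable F) :
    ∫⁻ y, F y ∂(coordSampling p g) =
      ∑ i, ENNReal.ofReal (p i) * F (EuclideanSpace.single i (g i)) := by
  change ∫⁻ y, F y ∂(∑ i, ENNReal.ofReal (p i) • Measure.dirac (EuclideanSpace.single i (g i))) = _
  rw [lintegral_finsetSum_measure]
  refine Finset.sum_congr rfl fun i _ => ?_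
  rw [lintegral_smul_measure, lintegral_dirac' _ hF, smul_eq_mul]

theorem sum_ofReal_eq_one {p : Fin d → ℝ} (hp : p ∈ stdSimplex ℝ (Fin d)) :
    ∑ i, ENNReal.ofReal (p i) = 1 := by
  rw [← ENNReal.ofReal_sum_of_nonneg fun i _ => hp.1 i, hp.2, ENNReal.ofReal_one]

theorem isMarkovKernel_coordSampling {p : Fin d → ℝ} (hp : p ∈ stdSimplex ℝ (Fin d)) :
    IsMarkovKernel (coordSampling p) := by
  refine ⟨fun g => ⟨?_⟩⟩
  rw [← lintegral_one, lintegral_coordSampling p g measurable_const]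
  simpa using sum_ofReal_eq_one hp

instance {Ω : Type} [MeasurableSpace Ω] (S : ChannelStrategy (obliviousChannels d) Ω) (t : ℕ) :
    IsMarkovKernel (S.kernel t) := by
  refine ⟨fun q => ?_⟩
  obtain ⟨p, hp, h⟩ := S.mem t q.1.1 q.1.2
  have := isMarkovKernel_coordSampling hp
  change IsProbabilityMeasure (S.channel t q.1.1 q.1.2 q.2)
  rw [h]
  infer_instance

variable {X : Set (Vec d)} {T : ℕ}

instance (O : Kernel X (Vec d)) [IsMarkovKernel O] (π : Algorithm X T)
    (S : ChannelStrategy (obliviousChannels d) π.Seed) (t : ℕ) :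
    IsMarkovKernel (stepKernel O π S t) := by
  unfold stepKernel; infer_instance

theorem measurable_snoc (t : ℕ) :
    Measurable fun q : Hist d t × Vec d => (Fin.snoc (α := fun _ => Vec d) q.1 q.2 : Hist d (t + 1)) :=
  (Continuous.finSnoc (A := fun _ => Vec d) continuous_fst continuous_snd).measurable

instance isMarkovKernel_transcript (O : Kernel X (Vec d)) [IsMarkovKernel O] (π : Algorithm X T)
    (S : ChannelStrategy (obliviousChannels d) π.Seed) (t : ℕ) :
    IsMarkovKernel (transcript O π S t) := by
  induction t with
  | zero => unfold transcript; infer_instance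
  | succ t ih => exact Kernel.IsMarkovKernel.map _ (measurable_snoc t)

theorem lintegral_stepKernel (O : Kernel X (Vec d)) [IsMarkovKernel O] (π : Algorithm X T)
    (S : ChannelStrategy (obliviousChannels d) π.Seed) (t : ℕ) (q : π.Seed × Hist d t)
    {p : Fin d → ℝ} (hp : S.channel t q.1 q.2 = coordSampling p)
    {F : Vec d → ℝ≥0∞} (hF : Measurable F) :
    ∫⁻ y, F y ∂(stepKernel O π S t q) =
      ∫⁻ g, ∑ i, ENNReal.ofReal (p i) * F (EuclideanSpace.single i (g i)) ∂(O (π.query t q)) := by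
  unfold stepKernel
  rw [Kernel.lintegral_snd _ _ hF, Kernel.lintegral_compProd _ _ _ (f := fun bc => F bc.2) (hF.comp measurable_snd),
    Kernel.lintegral_comap]
  refine lintegral_congr fun g => ?_
  rw [← lintegral_coordSampling p g hF, ← hp]
  rfl

theorem lintegral_transcript_zero (O : Kernel X (Vec d)) (π : Algorithm X T)
    (S : ChannelStrategy (obliviousChannels d) π.Seed) (ω : π.Seed)
    {F : Hist d 0 → ℝ≥0∞} (hF : Measurable F) :
    ∫⁻ h, F h ∂(transcript O π S 0 ω) = F Fin.elim0 := by
  change ∫⁻ h, F h ∂(Measure.dirac Fin.elim0) = _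
  rw [lintegral_dirac' _ hF]

theorem lintegral_transcript_succ (O : Kernel X (Vec d)) [IsMarkovKernel O] (π : Algorithm X T)
    (S : ChannelStrategy (obliviousChannels d) π.Seed) (t : ℕ) (ω : π.Seed)
    {F : Hist d (t + 1) → ℝ≥0∞} (hF : Measurable F) :
    ∫⁻ h, F h ∂(transcript O π S (t + 1) ω) =
      ∫⁻ h, ∫⁻ y, F (Fin.snoc (α := fun _ => Vec d) h y) ∂(stepKernel O π S t (ω, h))
        ∂(transcript O π S t ω) := by
  have hFs := hF.comp (measurable_snoc t)
  rw [transcript, Kernel.lintegral_map _ (measurable_snoc t) _ hF]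
  exact Kernel.lintegral_compProd _ _ _ hFs

end Kernels

/-! ### Nearest points in convex sets. -/

section Projection

variable {d : ℕ} {X : Set (Vec d)}

theorem inner_sub_nearest_nonpos (hX : Convex ℝ X) {u v : Vec d} (hv : v ∈ X)
    (h : ∀ z ∈ X, ‖v - u‖ ≤ ‖z - u‖) {z : Vec d} (hz : z ∈ X) : ⟪u - v, z - v⟫ ≤ 0 := by
  refine (norm_eq_iInf_iff_real_inner_le_zero hX hv).1 ?_ z hz
  have : Nonempty X := ⟨⟨v, hv⟩⟩
  refine le_antisymm (le_ciInf fun w => ?_) ?_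
  · simpa only [norm_sub_rev] using h w w.2
  · exact ciInf_le ⟨0, by rintro _ ⟨w, rfl⟩; exact norm_nonneg _⟩ (⟨v, hv⟩ : X)

theorem norm_nearest_sub_sq_le (hX : Convex ℝ X) {u v : Vec d} (hv : v ∈ X)
    (h : ∀ z ∈ X, ‖v - u‖ ≤ ‖z - u‖) {z : Vec d} (hz : z ∈ X) :
    ‖v - z‖ ^ 2 ≤ ‖u - z‖ ^ 2 := by
  have h1 := inner_sub_nearest_nonpos hX hv h hz
  have h2 : u - z = (u - v) - (z - v) := by abel
  rw [h2, norm_sub_sq_real (u - v), norm_sub_rev v z]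
  nlinarith [sq_nonneg ‖u - v‖]

theorem exists_measurable_nearest (hX : Convex ℝ X) (hne : X.Nonempty) (hc : IsCompact X) :
    ∃ P : Vec d → X, Measurable P ∧ ∀ u, ∀ z ∈ X, ‖(P u : Vec d) - u‖ ≤ ‖z - u‖ := by
  have hex : ∀ u : Vec d, ∃ v : X, ∀ z ∈ X, ‖(v : Vec d) - u‖ ≤ ‖z - u‖ := fun u => by
    obtain ⟨v, hv, h⟩ := hc.exists_isMinOn hne
      (f := fun z => ‖z - u‖) (by fun_prop)
    exact ⟨⟨v, hv⟩, fun z hz => h hz⟩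
  choose P hP using hex
  refine ⟨P, ?_, hP⟩
  -- Adding the variational inequalities at `P u` and `P v` makes `P` nonexpansive; this is what
  -- gives measurability of the chosen projection.
  have hL : LipschitzWith 1 P := LipschitzWith.of_dist_le_mul fun u v => by
    rw [NNReal.coe_one, one_mul, Subtype.dist_eq, dist_eq_norm, dist_eq_norm]
    have h1 := inner_sub_nearest_nonpos hX (P u).2 (hP u) (P v).2
    have h2 := inner_sub_nearest_nonpos hX (P v).2 (hP v) (P u).2
    have h3 : ‖(P u : Vec d) - P v‖ ^ 2 ≤ ⟪u - v, (P u : Vec d) - P v⟫ := by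
      rw [← real_inner_self_eq_norm_sq]
      have e : ⟪u - v, (P u : Vec d) - P v⟫ - ⟪(P u : Vec d) - P v, (P u : Vec d) - P v⟫
          = -⟪u - P u, (P v : Vec d) - P u⟫ - ⟪v - P v, (P u : Vec d) - P v⟫ := by
        simp only [inner_sub_left, inner_sub_right]; ring
      linarith
    have h4 := real_inner_le_norm (u - v) ((P u : Vec d) - P v)
    by_contra! hlt
    nlinarith [norm_nonneg (u - v)]
  exact hL.continuous.measurable

end Projection

/-! ### Upper bound: projected coordinate descent. -/

section Descent

variable {d T : ℕ} {X : Set (Vec d)}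

/-- The query points of coordinate descent with projection map `P` and step size `α`. -/
def descentQuery (P : Vec d → X) (x₀ : X) (α : ℝ) : (t : ℕ) → Hist d t → X
  | 0, _ => x₀
  | t + 1, y => P (descentQuery P x₀ α t (fun i => y i.castSucc) - α • y (Fin.last t))

theorem measurable_descentQuery {P : Vec d → X} (hP : Measurable P) (x₀ : X) (α : ℝ) (t : ℕ) :
    Measurable (descentQuery P x₀ α t) := by
  induction t with
  | zero => exact measurable_const
  | succ t ih =>
    refine hP.comp (Measurable.sub ?_ ?_)
    · exact measurable_subtype_coe.comp
        (ih.comp (measurable_pi_lambda _ fun i => measurable_pi_apply _))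
    · exact (measurable_pi_apply (Fin.last t)).const_smul α

theorem exists_isCoordinateDescent (hX : Convex ℝ X) (hc : IsCompact X) (hT : 0 < T)
    (x₀ : X) (α : ℝ) : ∃ π : Algorithm X T, IsCoordinateDescent π x₀ α := by
  obtain ⟨P, hPm, hP⟩ := exists_measurable_nearest hX ⟨x₀, x₀.2⟩ hc
  have hq := measurable_descentQuery hPm x₀ α
  let avg : Unit × Hist d T → Vec d := fun z => (1 / (T : ℝ)) •
    ∑ t : Fin T, (descentQuery P x₀ α t (fun i => z.2 (Fin.castLE t.isLt.le i)) : Vec d)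
  have havg : ∀ z, avg z ∈ X := fun z => by
    have hT' : (T : ℝ) ≠ 0 := by positivity
    simp only [avg, Finset.smul_sum]
    exact hX.sum_mem (fun _ _ => by positivity) (by simp [hT']) fun t _ => Subtype.coe_prop _
  have hm : Measurable avg := by
    refine Measurable.const_smul (c := 1 / (T : ℝ)) ?_
    refine Finset.measurable_fun_sum _ fun t _ => ?_
    exact measurable_subtype_coe.comp ((hq t).comp
      (measurable_pi_lambda _ fun i => (measurable_pi_apply _).comp measurable_snd))
  let π : Algorithm X T :=
    { Seed := Unit
      seedLaw := Measure.dirac ()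
      query := fun t z => descentQuery P x₀ α t z.2
      measurable_query := fun t => (hq t).comp measurable_snd
      output := fun z => ⟨avg z, havg z⟩
      measurable_output := hm.subtype_mk }
  exact ⟨π, fun _ _ => rfl, fun t ω y z hz => hP _ z hz, fun _ _ => rfl⟩

variable {B : ℝ} {f : Vec d → ℝ} {O : Kernel X (Vec d)}

theorem integrable_oracle (hf : (f, O) ∈ ConvexLipschitz X B) (hB : 0 ≤ B) (x : X) :
    Integrable (fun g => g) (O x) := by
  have := hf.2.1
  refine Integrable.of_bound measurable_id.aestronglyMeasurable B ?_
  filter_upwards [hf.2.2.2 x] with g hg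
  exact le_of_sq_le_sq hg hB

theorem norm_integral_oracle_le (hf : (f, O) ∈ ConvexLipschitz X B) (hB : 0 ≤ B) (x : X) :
    ‖∫ g, g ∂(O x)‖ ≤ B := by
  have := hf.2.1
  have := norm_integral_le_of_norm_le_const (μ := O x) (f := fun g => g) (C := B) (by
    filter_upwards [hf.2.2.2 x] with g hg
    exact le_of_sq_le_sq hg hB)
  simpa using this

/-- Convexity alone does not give continuity at the boundary of `X`. Here the mean oracle answer is
a subgradient of norm at most `B` at every point, so `f` is `B`-Lipschitz; this supplies both
measurability and a minimizer. -/
theorem continuous_of_mem_convexLipschitz (hf : (f, O) ∈ ConvexLipschitz X B) (hB : 0 ≤ B) :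
    Continuous fun x : X => f x := by
  have hle : ∀ x y : X, f x - f y ≤ B * dist x y := fun x y => by
    have h1 : f x + ⟪∫ g, g ∂(O x), (y : Vec d) - x⟫ ≤ f y := hf.2.2.1 x y y.2
    have h2 := (abs_le.1 (abs_real_inner_le_norm (∫ g, g ∂(O x)) ((y : Vec d) - x))).1
    have h3 := mul_le_mul_of_nonneg_right (norm_integral_oracle_le hf hB x)
      (norm_nonneg ((y : Vec d) - x))
    rw [Subtype.dist_eq, dist_comm, dist_eq_norm]
    linarith
  have : LipschitzWith B.toNNReal fun x : X => f x := LipschitzWith.of_dist_le_mul fun x y => by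
    rw [Real.coe_toNNReal _ hB, Real.dist_eq, abs_sub_le_iff]
    exact ⟨hle x y, dist_comm x y ▸ hle y x⟩
  exact this.continuous

/-- The squared distance of the current point to `z`, plus the weighted sum of the optimality gaps
with respect to `z` of the earlier ones. -/
noncomputable def descentPotential (π : Algorithm X T) (f : Vec d → ℝ) (z : Vec d) (c : ℝ) (ω : π.Seed) (t : ℕ)
    (h : Hist d t) : ℝ :=
  ‖(π.query t (ω, h) : Vec d) - z‖ ^ 2 +
    c * ∑ s : Fin t, (f (π.query s (ω, fun i => h (Fin.castLE s.isLt.le i))) - f z)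

theorem measurable_descentPotential (π : Algorithm X T) (hf : Continuous fun x : X => f x)
    (z : Vec d) (c : ℝ) (ω : π.Seed) (t : ℕ) : Measurable (descentPotential π f z c ω t) := by
  have hq : ∀ s, Measurable fun h : Hist d s => π.query s (ω, h) := fun s =>
    (π.measurable_query s).comp measurable_prodMk_left
  unfold descentPotential
  refine Measurable.add ?_ (Measurable.const_mul (Finset.measurable_sum _ fun s _ => ?_) c)
  · exact (((measurable_subtype_coe.comp (hq t)).sub_const z).norm).pow_const 2
  · refine Measurable.sub_const (hf.measurable.comp ((hq s).comp ?_)) _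
    exact measurable_pi_lambda _ fun i => measurable_pi_apply _

/-- Projection onto `X` brings the iterate no farther from `z`, so it suffices to expand the square
of the unprojected step, which moves along one coordinate only. -/
theorem descentPotential_snoc_le (hX : Convex ℝ X) {π : Algorithm X T} {x₀ : X} {α : ℝ}
    (hπ : IsCoordinateDescent π x₀ α) {z : Vec d} (hz : z ∈ X) (c : ℝ) (ω : π.Seed) (t : ℕ)
    (h : Hist d t) (j : Fin d) (a : ℝ) :
    descentPotential π f z c ω (t + 1)
        (Fin.snoc (α := fun _ => Vec d) h (EuclideanSpace.single j a)) ≤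
      descentPotential π f z c ω t h + c * (f (π.query t (ω, h)) - f z)
        - 2 * α * (a * ((π.query t (ω, h) : Vec d) - z) j) + α ^ 2 * a ^ 2 := by
  have h1 := norm_nearest_sub_sq_le hX (Subtype.coe_prop _)
    (hπ.2.1 t ω (Fin.snoc (α := fun _ => Vec d) h (EuclideanSpace.single j a))) hz
  simp only [Fin.snoc_castSucc, Fin.snoc_last] at h1
  have h2 : ∀ s : Fin t, (fun i : Fin s => (Fin.snoc (α := fun _ => Vec d) h
      (EuclideanSpace.single j a) : Hist d (t + 1)) (Fin.castLE s.castSucc.isLt.le i)) =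
      fun i => h (Fin.castLE s.isLt.le i) := fun s => by
    funext i
    exact Fin.snoc_castSucc (α := fun _ => Vec d) _ _ (Fin.castLE s.isLt.le i)
  have h3 : (fun i : Fin t => (Fin.snoc (α := fun _ => Vec d) h
      (EuclideanSpace.single j a) : Hist d (t + 1)) (Fin.castLE (Fin.last t).isLt.le i)) = h := by
    funext i
    exact Fin.snoc_castSucc (α := fun _ => Vec d) _ _ i
  have h4 : ‖(π.query t (ω, h) : Vec d) - α • EuclideanSpace.single j a - z‖ ^ 2 =
      ‖(π.query t (ω, h) : Vec d) - z‖ ^ 2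
        - 2 * α * (a * ((π.query t (ω, h) : Vec d) - z) j) + α ^ 2 * a ^ 2 := by
    rw [sub_right_comm, norm_sub_sq_real, inner_smul_right, EuclideanSpace.inner_single_right,
      norm_smul, mul_pow]
    simp
    ring
  rw [h4] at h1
  unfold descentPotential
  rw [Fin.sum_univ_castSucc]
  have h5 : ∀ s : Fin t, π.query (s.castSucc : Fin (t + 1)) (ω, fun i => (Fin.snoc
      (α := fun _ => Vec d) h (EuclideanSpace.single j a) : Hist d (t + 1))
        (Fin.castLE s.castSucc.isLt.le i)) = π.query s (ω, fun i => h (Fin.castLE s.isLt.le i)) :=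
    fun s => congrArg (fun y => π.query s (ω, y)) (h2 s)
  have h6 : π.query (Fin.last t : Fin (t + 1)) (ω, fun i => (Fin.snoc
      (α := fun _ => Vec d) h (EuclideanSpace.single j a) : Hist d (t + 1))
        (Fin.castLE (Fin.last t).isLt.le i)) = π.query t (ω, h) :=
    congrArg (fun y => π.query t (ω, y)) h3
  simp only [h5, h6]
  linarith

theorem descentPotential_nonneg {π : Algorithm X T} {z : Vec d} (hz : ∀ x ∈ X, f z ≤ f x) {c : ℝ}
    (hc : 0 ≤ c) (ω : π.Seed) (t : ℕ) (h : Hist d t) : 0 ≤ descentPotential π f z c ω t h :=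
  add_nonneg (sq_nonneg _) (mul_nonneg hc (Finset.sum_nonneg fun _ _ =>
    sub_nonneg.2 (hz _ (Subtype.coe_prop _))))

/-- The weight `2α/d` is chosen so that the mean drift `-(2α/d) ⟪x - z, 𝔼 g⟫` cancels the newly
added gap, by the subgradient inequality. Only the second-moment term survives. -/
theorem lintegral_descentPotential_snoc_le (hd : 1 ≤ d) (hX : Convex ℝ X) (hB : 0 ≤ B)
    (hf : (f, O) ∈ ConvexLipschitz X B) {π : Algorithm X T} {x₀ : X} {α : ℝ} (hα : 0 ≤ α)
    (hπ : IsCoordinateDescent π x₀ α) {z : Vec d} (hz : z ∈ X) (hmin : ∀ x ∈ X, f z ≤ f x)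
    (ω : π.Seed) (t : ℕ) (h : Hist d t) :
    ∫⁻ y, ENNReal.ofReal (descentPotential π f z (2 * α / d) ω (t + 1)
        (Fin.snoc (α := fun _ => Vec d) h y))
        ∂(stepKernel O π (ChannelStrategy.const (uniformSampling_mem hd)) t (ω, h)) ≤
      ENNReal.ofReal (descentPotential π f z (2 * α / d) ω t h + α ^ 2 * B ^ 2 / d) := by
  have := hf.2.1
  have hd0 : (0 : ℝ) < d := by exact_mod_cast hd
  have hc : 0 ≤ 2 * α / d := by positivity
  have hmeas := measurable_descentPotential π (continuous_of_mem_convexLipschitz hf hB) z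
    (2 * α / d) ω (t + 1)
  rw [lintegral_stepKernel O π _ t (ω, h) (p := fun _ => 1 / (d : ℝ)) rfl
    (F := fun y => ENNReal.ofReal (descentPotential π f z (2 * α / d) ω (t + 1)
        (Fin.snoc (α := fun _ => Vec d) h y)))
    ((hmeas.comp ((measurable_snoc t).comp measurable_prodMk_left)).ennreal_ofReal)]
  set x : X := π.query t (ω, h) with hx
  set V := descentPotential π f z (2 * α / d) ω t h + 2 * α / d * (f x - f z) with hV
  let Q : Vec d → ℝ := fun g => V - 2 * α / d * ⟪(x : Vec d) - z, g⟫ + α ^ 2 / d * ‖g‖ ^ 2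
  have hQsum : ∀ g : Vec d, ∑ j, 1 / (d : ℝ) *
      (V - 2 * α * (g j * ((x : Vec d) - z) j) + α ^ 2 * g j ^ 2) = Q g := fun g => by
    simp only [Q]
    rw [EuclideanSpace.real_norm_sq_eq, PiLp.inner_apply, ← Finset.mul_sum, Finset.sum_add_distrib,
      Finset.sum_sub_distrib, ← Finset.mul_sum, ← Finset.mul_sum]
    simp only [Finset.sum_const, Finset.card_univ, Fintype.card_fin, nsmul_eq_mul,
      RCLike.inner_apply, conj_trivial]
    field_simp
  have hpt : ∀ (g : Vec d) (j : Fin d),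
      descentPotential π f z (2 * α / d) ω (t + 1)
        (Fin.snoc (α := fun _ => Vec d) h (EuclideanSpace.single j (g j))) ≤
      V - 2 * α * (g j * ((x : Vec d) - z) j) + α ^ 2 * g j ^ 2 := fun g j =>
    descentPotential_snoc_le hX hπ hz _ ω t h j (g j)
  -- The bound inherits nonnegativity from the potential, which is where minimality of `z` enters.
  -- It allows `ENNReal.ofReal` to be moved through the sum over `j` and the integral over `g`.
  have hterm : ∀ (g : Vec d) (j : Fin d),
      0 ≤ V - 2 * α * (g j * ((x : Vec d) - z) j) + α ^ 2 * g j ^ 2 := fun g j =>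
    (descentPotential_nonneg hmin hc ω _ _).trans (hpt g j)
  have hQ0 : ∀ g, 0 ≤ Q g := fun g => by
    rw [← hQsum]
    exact Finset.sum_nonneg fun j _ => mul_nonneg (by positivity) (hterm g j)
  have hint := integrable_oracle hf hB x
  have hsq : Integrable (fun g : Vec d => ‖g‖ ^ 2) (O x) := by
    refine Integrable.of_bound (C := B ^ 2) (by fun_prop) ?_
    filter_upwards [hf.2.2.2 x] with g hg
    rwa [Real.norm_of_nonneg (sq_nonneg _)]
  have hinn : Integrable (fun g : Vec d => ⟪(x : Vec d) - z, g⟫) (O x) := hint.const_inner _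
  have hsqle : ∫ g, ‖g‖ ^ 2 ∂(O x) ≤ B ^ 2 := by
    calc ∫ g, ‖g‖ ^ 2 ∂(O x) ≤ ∫ _, B ^ 2 ∂(O x) :=
          integral_mono_ae hsq (integrable_const _) (hf.2.2.2 x)
      _ = B ^ 2 := by simp
  have hsub : f x + ⟪∫ g, g ∂(O x), z - x⟫ ≤ f z := hf.2.2.1 x z hz
  have hQint : Integrable Q (O x) :=
    ((integrable_const V).sub (hinn.const_mul _)).add (hsq.const_mul _)
  have hQval : ∫ g, Q g ∂(O x) = V - 2 * α / d * ⟪(x : Vec d) - z, ∫ g, g ∂(O x)⟫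
      + α ^ 2 / d * ∫ g, ‖g‖ ^ 2 ∂(O x) := by
    simp only [Q]
    rw [integral_add (f := fun g => V - 2 * α / d * ⟪(x : Vec d) - z, g⟫)
        ((integrable_const V).sub (hinn.const_mul _)) (hsq.const_mul _),
      integral_sub (integrable_const V) (hinn.const_mul _), integral_const_mul,
      integral_const_mul, integral_inner hint]
    simp
  calc ∫⁻ g, ∑ j, ENNReal.ofReal (1 / (d : ℝ)) *
        ENNReal.ofReal (descentPotential π f z (2 * α / d) ω (t + 1)
          (Fin.snoc (α := fun _ => Vec d) h (EuclideanSpace.single j (g j)))) ∂(O x)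
      ≤ ∫⁻ g, ENNReal.ofReal (Q g) ∂(O x) := by
        refine lintegral_mono fun g => ?_
        dsimp only
        rw [← hQsum, ENNReal.ofReal_sum_of_nonneg
          fun j _ => mul_nonneg (by positivity) (hterm g j)]
        refine Finset.sum_le_sum fun j _ => ?_
        rw [← ENNReal.ofReal_mul (by positivity)]
        exact ENNReal.ofReal_le_ofReal (mul_le_mul_of_nonneg_left (hpt g j) (by positivity))
    _ = ENNReal.ofReal (∫ g, Q g ∂(O x)) :=
        (ofReal_integral_eq_lintegral_ofReal hQint (ae_of_all _ hQ0)).symm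
    _ ≤ _ := by
        refine ENNReal.ofReal_le_ofReal ?_
        rw [hQval, hV]
        have e : ⟪∫ g, g ∂(O x), z - x⟫ = -⟪(x : Vec d) - z, ∫ g, g ∂(O x)⟫ := by
          rw [real_inner_comm, ← neg_sub (x : Vec d) z, inner_neg_left]
        rw [e] at hsub
        have h1 := mul_le_mul_of_nonneg_left hsqle (show 0 ≤ α ^ 2 / d by positivity)
        have h2 := mul_le_mul_of_nonneg_left hsub hc
        have h3 : α ^ 2 * B ^ 2 / d = α ^ 2 / d * B ^ 2 := by ring
        rw [h3]
        linarith

theorem lintegral_descentPotential_le (hd : 1 ≤ d) (hX : Convex ℝ X) (hB : 0 ≤ B)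
    (hf : (f, O) ∈ ConvexLipschitz X B) {π : Algorithm X T} {x₀ : X} {α : ℝ} (hα : 0 ≤ α)
    (hπ : IsCoordinateDescent π x₀ α) {z : Vec d} (hz : z ∈ X) (hmin : ∀ x ∈ X, f z ≤ f x)
    (ω : π.Seed) (t : ℕ) :
    ∫⁻ h, ENNReal.ofReal (descentPotential π f z (2 * α / d) ω t h)
        ∂(transcript O π (ChannelStrategy.const (uniformSampling_mem hd)) t ω) ≤
      ENNReal.ofReal (‖(x₀ : Vec d) - z‖ ^ 2 + t * (α ^ 2 * B ^ 2 / d)) := by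
  have := hf.2.1
  have hmeas := measurable_descentPotential π (continuous_of_mem_convexLipschitz hf hB) z
    (2 * α / d) ω
  have hpos : ∀ t h, 0 ≤ descentPotential π f z (2 * α / d) ω t h := fun t h =>
    descentPotential_nonneg hmin (by positivity) ω t h
  induction t with
  | zero =>
    rw [lintegral_transcript_zero _ _ _ _ (hmeas 0).ennreal_ofReal]
    simp [descentPotential, hπ.1]
  | succ t ih =>
    rw [lintegral_transcript_succ _ _ _ _ _ (hmeas (t + 1)).ennreal_ofReal]
    refine (lintegral_mono fun h =>
      lintegral_descentPotential_snoc_le hd hX hB hf hα hπ hz hmin ω t h).trans ?_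
    simp_rw [ENNReal.ofReal_add (hpos t _) (show 0 ≤ α ^ 2 * B ^ 2 / d by positivity)]
    rw [lintegral_add_right _ measurable_const, lintegral_const, measure_univ, mul_one]
    refine (add_le_add_left ih _).trans ?_
    rw [← ENNReal.ofReal_add (by positivity) (by positivity)]
    refine ENNReal.ofReal_le_ofReal (le_of_eq ?_)
    push_cast
    ring

/-- Coordinate descent with uniform sampling and a constant step size. -/
theorem worstError_coordinateDescent_le (hd : 1 ≤ d) (hT : 0 < T) (hX : Convex ℝ X)
    (hc : IsCompact X) {D : ℝ} (hD : ∀ x ∈ X, ∀ y ∈ X, ‖x - y‖ ≤ D) (hB : 0 ≤ B)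
    {π : Algorithm X T} {x₀ : X} {α : ℝ} (hα : 0 < α) (hπ : IsCoordinateDescent π x₀ α) :
    worstError (ConvexLipschitz X B) π (ChannelStrategy.const (uniformSampling_mem hd)) ≤
      ENNReal.ofReal (d * D ^ 2 / (2 * α * T) + α * B ^ 2 / 2) := by
  refine iSup₂_le fun fO hf => ?_
  obtain ⟨f, O⟩ := fO
  have := hf.2.1
  have hd0 : (0 : ℝ) < d := by exact_mod_cast hd
  have hT0 : (0 : ℝ) < T := by exact_mod_cast hT
  have hfc := continuous_of_mem_convexLipschitz hf hB
  obtain ⟨z, hz, hmin⟩ := hc.exists_isMinOn ⟨x₀, x₀.2⟩ (continuousOn_iff_continuous_domRestrict.2 hfc)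
  have hmin' : ∀ x ∈ X, f z ≤ f x := fun x hx => hmin hx
  have : Nonempty X := ⟨x₀⟩
  have hinf : ⨅ x : X, f x = f z := le_antisymm
    (ciInf_le ⟨f z, by rintro _ ⟨x, rfl⟩; exact hmin' x x.2⟩ (⟨z, hz⟩ : X))
    (le_ciInf fun x => hmin' x x.2)
  -- Jensen's inequality for the averaged output; the distance term of the potential is discarded.
  have hgap : ∀ ω h, f (π.output (ω, h)) - f z ≤
      d / (2 * α * T) * descentPotential π f z (2 * α / d) ω T h := fun ω h => by
    have h1 : f (π.output (ω, h)) ≤ ∑ t : Fin T, 1 / (T : ℝ) *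
        f (π.query t (ω, fun i => h (Fin.castLE t.isLt.le i))) := by
      rw [hπ.2.2, Finset.smul_sum]
      exact hf.1.map_sum_le (fun _ _ => by positivity) (by simp [hT0.ne'])
        fun t _ => Subtype.coe_prop _
    rw [← Finset.mul_sum] at h1
    have h2 : d / (2 * α * T) * descentPotential π f z (2 * α / d) ω T h =
        d / (2 * α * T) * ‖(π.query T (ω, h) : Vec d) - z‖ ^ 2 + (1 / (T : ℝ) *
        ∑ t : Fin T, f (π.query t (ω, fun i => h (Fin.castLE t.isLt.le i))) - f z) := by
      unfold descentPotential
      rw [Finset.sum_sub_distrib]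
      simp only [Finset.sum_const, Finset.card_univ, Fintype.card_fin, nsmul_eq_mul]
      field_simp
    rw [h2]
    have h3 : 0 ≤ d / (2 * α * T) * ‖(π.query T (ω, h) : Vec d) - z‖ ^ 2 := by positivity
    linarith
  have hmeas : Measurable fun z => ENNReal.ofReal (f (π.output z) - ⨅ x : X, f x) :=
    ((hfc.measurable.comp π.measurable_output).sub_const _).ennreal_ofReal
  unfold error
  rw [Measure.lintegral_compProd hmeas]
  have hω : ∀ ω, ∫⁻ h, ENNReal.ofReal (f (π.output (ω, h)) - ⨅ x : X, f x)
      ∂(transcript O π (ChannelStrategy.const (uniformSampling_mem hd)) T ω) ≤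
      ENNReal.ofReal (d * D ^ 2 / (2 * α * T) + α * B ^ 2 / 2) := fun ω => by
    calc _ ≤ ∫⁻ h, ENNReal.ofReal (d / (2 * α * T)) *
          ENNReal.ofReal (descentPotential π f z (2 * α / d) ω T h)
          ∂(transcript O π (ChannelStrategy.const (uniformSampling_mem hd)) T ω) := by
          refine lintegral_mono fun h => ?_
          dsimp only
          rw [← ENNReal.ofReal_mul (by positivity), hinf]
          exact ENNReal.ofReal_le_ofReal (hgap ω h)
      _ ≤ ENNReal.ofReal (d / (2 * α * T)) *
          ENNReal.ofReal (‖(x₀ : Vec d) - z‖ ^ 2 + T * (α ^ 2 * B ^ 2 / d)) := by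
          rw [lintegral_const_mul' _ _ ENNReal.ofReal_ne_top]
          gcongr
          exact lintegral_descentPotential_le hd hX hB hf hα.le hπ hz hmin' ω T
      _ ≤ _ := by
          rw [← ENNReal.ofReal_mul (by positivity)]
          refine ENNReal.ofReal_le_ofReal ?_
          have h1 : ‖(x₀ : Vec d) - z‖ ^ 2 ≤ D ^ 2 :=
            pow_le_pow_left₀ (norm_nonneg _) (hD _ x₀.2 _ hz) 2
          calc _ ≤ d / (2 * α * T) * (D ^ 2 + T * (α ^ 2 * B ^ 2 / d)) := by gcongr
            _ = _ := by field_simp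
  calc _ ≤ ∫⁻ _, ENNReal.ofReal (d * D ^ 2 / (2 * α * T) + α * B ^ 2 / 2) ∂π.seedLaw :=
        lintegral_mono hω
    _ = _ := by simp

end Descent

/-! ### Lower bound: the hard instances. -/

section SignOracle

variable {d : ℕ}

/-- The vector in `{-1, 1}^d` with the given signs. -/
noncomputable def signVec (v : Fin d → ℤˣ) : Vec d := WithLp.toLp 2 fun i => ((v i : ℤ) : ℝ)

/-- Change the `i`-th sign. -/
def flipSign (i : Fin d) : (Fin d → ℤˣ) ≃ (Fin d → ℤˣ) := Equiv.mulRight (Pi.mulSingle i (-1))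

theorem signVec_flipSign_self (i : Fin d) (v : Fin d → ℤˣ) :
    signVec (flipSign i v) i = -signVec v i := by
  simp [signVec, flipSign]

theorem signVec_flipSign_of_ne {i j : Fin d} (h : j ≠ i) (v : Fin d → ℤˣ) :
    signVec (flipSign i v) j = signVec v j := by
  simp [signVec, flipSign, h]

theorem signVec_eq_or (v : Fin d → ℤˣ) (i : Fin d) : signVec v i = 1 ∨ signVec v i = -1 := by
  rcases Int.units_eq_one_or (v i) with h | h <;> simp [signVec, h]

theorem signVec_sq (v : Fin d → ℤˣ) (i : Fin d) : signVec v i ^ 2 = 1 := by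
  rcases signVec_eq_or v i with h | h <;> simp [h]

theorem abs_signVec (v : Fin d → ℤˣ) (i : Fin d) : |signVec v i| = 1 := by
  rcases signVec_eq_or v i with h | h <;> simp [h]

theorem norm_signVec_sq (v : Fin d → ℤˣ) : ‖signVec v‖ ^ 2 = d := by
  simp [EuclideanSpace.real_norm_sq_eq, signVec_sq]

/-- The law on `{s u, -s u}`, where `u` is the sign vector of `v`, with mean `κ s u`. -/
noncomputable def signLaw (s κ : ℝ) (v : Fin d → ℤˣ) : Measure (Vec d) :=
  ENNReal.ofReal ((1 + κ) / 2) • Measure.dirac (s • signVec v) +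
    ENNReal.ofReal ((1 - κ) / 2) • Measure.dirac (-(s • signVec v))

theorem isProbabilityMeasure_signLaw (s : ℝ) {κ : ℝ} (h0 : 0 ≤ κ) (h1 : κ ≤ 1)
    (v : Fin d → ℤˣ) : IsProbabilityMeasure (signLaw s κ v) := by
  constructor
  simp only [signLaw, Measure.add_apply, Measure.smul_apply, measure_univ, smul_eq_mul, mul_one]
  rw [← ENNReal.ofReal_add (by linarith) (by linarith),
    show (1 + κ) / 2 + (1 - κ) / 2 = 1 by ring, ENNReal.ofReal_one]

theorem ae_signLaw {s κ : ℝ} {v : Fin d → ℤˣ} {p : Vec d → Prop} (hp : MeasurableSet {x | p x})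
    (h1 : p (s • signVec v)) (h2 : p (-(s • signVec v))) : ∀ᵐ g ∂(signLaw s κ v), p g := by
  rw [signLaw, ae_add_measure_iff]
  exact ⟨Measure.ae_smul_measure ((ae_dirac_iff hp).2 h1) _,
    Measure.ae_smul_measure ((ae_dirac_iff hp).2 h2) _⟩

theorem integral_signLaw (s : ℝ) {κ : ℝ} (h0 : 0 ≤ κ) (h1 : κ ≤ 1) (v : Fin d → ℤˣ) :
    ∫ g, g ∂(signLaw s κ v) = (κ * s) • signVec v := by
  have hi : ∀ a : Vec d, Integrable (fun g : Vec d => g) (Measure.dirac a) := fun a =>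
    integrable_dirac (by simp [enorm_lt_top])
  rw [signLaw, integral_add_measure ((hi _).smul_measure ENNReal.ofReal_ne_top)
    ((hi _).smul_measure ENNReal.ofReal_ne_top), integral_smul_measure, integral_smul_measure,
    integral_dirac, integral_dirac, ENNReal.toReal_ofReal (by linarith),
    ENNReal.toReal_ofReal (by linarith), smul_neg, smul_smul, smul_smul, ← sub_eq_add_neg,
    ← sub_smul]
  congr 1
  ring

/-- The oracle that always returns a sample of `signLaw s κ v`. -/
noncomputable def signOracle (X : Set (Vec d)) (s κ : ℝ) (v : Fin d → ℤˣ) : Kernel X (Vec d) :=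
  Kernel.const X (signLaw s κ v)

variable {X : Set (Vec d)} {T : ℕ}

theorem isMarkovKernel_signOracle (s : ℝ) {κ : ℝ} (h0 : 0 ≤ κ) (h1 : κ ≤ 1) (v : Fin d → ℤˣ) :
    IsMarkovKernel (signOracle X s κ v) :=
  ⟨fun _ => isProbabilityMeasure_signLaw s h0 h1 v⟩

theorem signOracle_mem_convexLipschitz (hX : Convex ℝ X) {s κ B : ℝ} (h0 : 0 ≤ κ) (h1 : κ ≤ 1)
    (hs : s ^ 2 * d ≤ B ^ 2) (v : Fin d → ℤˣ) :
    ((fun x => ⟪(κ * s) • signVec v, x⟫), signOracle X s κ v) ∈ ConvexLipschitz X B := by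
  refine ⟨(innerₗ (Vec d) ((κ * s) • signVec v)).convexOn hX, isMarkovKernel_signOracle s h0 h1 v,
    fun x y _ => ?_, fun x => ae_signLaw (measurableSet_le (by fun_prop) (by fun_prop)) ?_ ?_⟩
  · change _ + ⟪∫ g, g ∂(signLaw s κ v), y - x⟫ ≤ _
    rw [integral_signLaw s h0 h1, inner_sub_right]
    simp
  · rwa [norm_smul, mul_pow, norm_signVec_sq, Real.norm_eq_abs, sq_abs]
  · rwa [norm_neg, norm_smul, mul_pow, norm_signVec_sq, Real.norm_eq_abs, sq_abs]

/-- The order of quantifiers is the point: `p` depends on the seed and the past only, so one `p`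
serves all signs `v` and all biases `κ`. This is where obliviousness is used. -/
theorem exists_lintegral_stepKernel_signOracle (π : Algorithm X T)
    (S : ChannelStrategy (obliviousChannels d) π.Seed) (t : ℕ) (q : π.Seed × Hist d t) (s : ℝ) :
    ∃ p ∈ stdSimplex ℝ (Fin d), ∀ {κ : ℝ}, 0 ≤ κ → κ ≤ 1 → ∀ (v : Fin d → ℤˣ)
      {F : Vec d → ℝ≥0∞}, Measurable F →
      ∫⁻ y, F y ∂(stepKernel (signOracle X s κ v) π S t q) =
        ∑ j, ENNReal.ofReal (p j) *
          (ENNReal.ofReal ((1 + κ * signVec v j) / 2) * F (EuclideanSpace.single j s) +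
            ENNReal.ofReal ((1 - κ * signVec v j) / 2) * F (EuclideanSpace.single j (-s))) := by
  obtain ⟨p, hp, h⟩ := S.mem t q.1 q.2
  refine ⟨p, hp, fun {κ} h0 h1 v F hF => ?_⟩
  have := isMarkovKernel_signOracle (X := X) s h0 h1 v
  rw [lintegral_stepKernel _ π S t q h hF]
  have hm : ∀ j : Fin d, Measurable fun g : Vec d =>
      ENNReal.ofReal (p j) * F (EuclideanSpace.single j (g j)) := fun j =>
    (hF.comp ((continuous_single j).measurable.comp (by fun_prop))).const_mul _
  rw [lintegral_finsetSum _ fun j _ => hm j]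
  refine Finset.sum_congr rfl fun j _ => ?_
  change ∫⁻ g, _ ∂(signLaw s κ v) = _
  rw [signLaw, lintegral_add_measure, lintegral_smul_measure, lintegral_smul_measure,
    lintegral_dirac' _ (hm j), lintegral_dirac' _ (hm j), smul_eq_mul, smul_eq_mul]
  -- A negative sign at `j` exchanges the roles of the two atoms of `signLaw`.
  rcases signVec_eq_or v j with e | e
  · simp [e]
    ring
  · simp only [e, PiLp.smul_apply, PiLp.neg_apply, smul_eq_mul, mul_neg, mul_one, neg_neg,
      ← sub_eq_add_neg, sub_neg_eq_add]
    ring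

end SignOracle

/-! ### Likelihood ratios and decay of the affinity. -/

section Likelihood

variable {d : ℕ} {X : Set (Vec d)} {T : ℕ}

/-- The likelihood ratio of the transcript for the signs `v` against fair coin flips. -/
noncomputable def likelihood (s κ : ℝ) (v : Fin d → ℤˣ) {t : ℕ} (h : Hist d t) : ℝ :=
  ∏ i, max 0 (1 + κ / s * ⟪signVec v, h i⟫)

theorem likelihood_nonneg (s κ : ℝ) (v : Fin d → ℤˣ) {t : ℕ} (h : Hist d t) :
    0 ≤ likelihood s κ v h :=
  Finset.prod_nonneg fun _ _ => le_max_left _ _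

theorem measurable_likelihood (s κ : ℝ) (v : Fin d → ℤˣ) (t : ℕ) :
    Measurable fun h : Hist d t => likelihood s κ v h := by
  unfold likelihood
  refine Finset.measurable_fun_prod _ fun i _ => ?_
  have : Measurable fun h : Hist d t => h i := measurable_pi_apply i
  fun_prop

/-- The truncation at `0` is inactive on outputs `±s e_j`, since `κ ≤ 1`. It only keeps the density
nonnegative on histories that never occur. -/
theorem likelihood_snoc_single {s κ : ℝ} (hs : s ≠ 0) (h0 : 0 ≤ κ) (h1 : κ ≤ 1)
    (v : Fin d → ℤˣ) {t : ℕ} (h : Hist d t) (j : Fin d) :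
    likelihood s κ v (Fin.snoc (α := fun _ => Vec d) h (EuclideanSpace.single j s)) =
        likelihood s κ v h * (1 + κ * signVec v j) ∧
      likelihood s κ v (Fin.snoc (α := fun _ => Vec d) h (EuclideanSpace.single j (-s))) =
        likelihood s κ v h * (1 - κ * signVec v j) := by
  have e : κ / s * (s * signVec v j) = κ * signVec v j := by field_simp
  unfold likelihood
  simp only [Fin.prod_univ_castSucc, Fin.snoc_castSucc, Fin.snoc_last,
    EuclideanSpace.inner_single_right, conj_trivial, neg_mul, mul_neg, e]
  constructor
  · rw [max_eq_right]
    rcases signVec_eq_or v j with e | e <;> rw [e] <;> linarith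
  · rw [max_eq_right, ← sub_eq_add_neg]
    rcases signVec_eq_or v j with e | e <;> rw [e] <;> linarith

/-- Change of measure to the transcript that arises from fair coin flips. -/
theorem lintegral_transcript_signOracle (π : Algorithm X T)
    (S : ChannelStrategy (obliviousChannels d) π.Seed) {s κ : ℝ} (hs : s ≠ 0) (h0 : 0 ≤ κ)
    (h1 : κ ≤ 1) (v : Fin d → ℤˣ) (ω : π.Seed) (t : ℕ) {F : Hist d t → ℝ≥0∞} (hF : Measurable F) :
    ∫⁻ h, F h ∂(transcript (signOracle X s κ v) π S t ω) =
      ∫⁻ h, F h * ENNReal.ofReal (likelihood s κ v h)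
        ∂(transcript (signOracle X s 0 1) π S t ω) := by
  have := isMarkovKernel_signOracle (X := X) s h0 h1 v
  -- With `κ = 0` the observed coins are fair whatever the signs, so the sign vector `1` in the
  -- reference oracle is an arbitrary choice.
  have := isMarkovKernel_signOracle (X := X) s le_rfl zero_le_one (1 : Fin d → ℤˣ)
  induction t with
  | zero =>
    have hm := measurable_likelihood s κ v 0
    rw [lintegral_transcript_zero _ _ _ _ hF,
      lintegral_transcript_zero _ _ _ _
        (F := fun h => F h * ENNReal.ofReal (likelihood s κ v h)) (hF.mul hm.ennreal_ofReal)]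
    simp [likelihood]
  | succ t ih =>
    have hm := measurable_likelihood s κ v (t + 1)
    have hFs := hF.comp (measurable_snoc t)
    rw [lintegral_transcript_succ _ _ _ _ _ hF,
      lintegral_transcript_succ _ _ _ _ _
        (F := fun h => F h * ENNReal.ofReal (likelihood s κ v h)) (hF.mul hm.ennreal_ofReal)]
    have hG : Measurable fun h : Hist d t => ∫⁻ y, F (Fin.snoc (α := fun _ => Vec d) h y)
        ∂(stepKernel (signOracle X s κ v) π S t (ω, h)) := by
      have : Measurable fun q : (π.Seed × Hist d t) × Vec d =>
          F (Fin.snoc (α := fun _ => Vec d) q.1.2 q.2) :=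
        hFs.comp (Measurable.prodMk (by fun_prop) (by fun_prop))
      exact this.lintegral_kernel_prod_right'.comp measurable_prodMk_left
    rw [ih hG]
    refine lintegral_congr fun h => ?_
    -- The same coordinate law `p` governs both transcripts, so it drops out of the likelihood
    -- ratio.
    obtain ⟨p, hp, hstep⟩ := exists_lintegral_stepKernel_signOracle π S t (ω, h) s
    have hFh : Measurable fun y => F (Fin.snoc (α := fun _ => Vec d) h y) :=
      hFs.comp measurable_prodMk_left
    have hmh : Measurable fun y => likelihood s κ v (Fin.snoc (α := fun _ => Vec d) h y) :=
      hm.comp ((measurable_snoc t).comp measurable_prodMk_left)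
    rw [hstep h0 h1 v hFh, hstep le_rfl zero_le_one 1
      (F := fun y => F (Fin.snoc (α := fun _ => Vec d) h y) * ENNReal.ofReal
        (likelihood s κ v (Fin.snoc (α := fun _ => Vec d) h y))) (hFh.mul hmh.ennreal_ofReal),
      Finset.sum_mul]
    refine Finset.sum_congr rfl fun j _ => ?_
    obtain ⟨e1, e2⟩ := likelihood_snoc_single hs h0 h1 v h j
    have hL := likelihood_nonneg s κ v h
    have a1 : ENNReal.ofReal ((1 + κ * signVec v j) / 2) * ENNReal.ofReal (likelihood s κ v h) =
        ENNReal.ofReal (1 / 2) *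
          ENNReal.ofReal (likelihood s κ v h * (1 + κ * signVec v j)) := by
      rw [← ENNReal.ofReal_mul' hL, ← ENNReal.ofReal_mul (by norm_num)]
      congr 1; ring
    have a2 : ENNReal.ofReal ((1 - κ * signVec v j) / 2) * ENNReal.ofReal (likelihood s κ v h) =
        ENNReal.ofReal (1 / 2) *
          ENNReal.ofReal (likelihood s κ v h * (1 - κ * signVec v j)) := by
      rw [← ENNReal.ofReal_mul' hL, ← ENNReal.ofReal_mul (by norm_num)]
      congr 1; ring
    rw [e1, e2, mul_assoc, add_mul, mul_right_comm, a1,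
      mul_right_comm (ENNReal.ofReal ((1 - κ * signVec v j) / 2)), a2]
    simp only [zero_mul, add_zero, sub_zero]
    ring

theorem lintegral_likelihood (π : Algorithm X T)
    (S : ChannelStrategy (obliviousChannels d) π.Seed) {s κ : ℝ} (hs : s ≠ 0) (h0 : 0 ≤ κ)
    (h1 : κ ≤ 1) (v : Fin d → ℤˣ) (ω : π.Seed) (t : ℕ) :
    ∫⁻ h, ENNReal.ofReal (likelihood s κ v h) ∂(transcript (signOracle X s 0 1) π S t ω) = 1 := by
  have := isMarkovKernel_signOracle (X := X) s h0 h1 v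
  have := lintegral_transcript_signOracle π S hs h0 h1 v ω t (F := fun _ => 1) measurable_const
  simpa using this.symm

/-- The Bhattacharyya affinities of the likelihoods of neighbouring sign vectors, summed over
all pairs of neighbours. -/
noncomputable def affinity (s κ : ℝ) {t : ℕ} (h : Hist d t) : ℝ :=
  ∑ v : Fin d → ℤˣ, ∑ i, √(likelihood s κ v h * likelihood s κ (flipSign i v) h)

theorem affinity_nonneg (s κ : ℝ) {t : ℕ} (h : Hist d t) : 0 ≤ affinity s κ h :=
  Finset.sum_nonneg fun _ _ => Finset.sum_nonneg fun _ _ => Real.sqrt_nonneg _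

theorem measurable_affinity (s κ : ℝ) (t : ℕ) : Measurable fun h : Hist d t => affinity s κ h :=
  Finset.measurable_fun_sum _ fun v _ => Finset.measurable_fun_sum _ fun i _ =>
    ((measurable_likelihood s κ v t).mul (measurable_likelihood s κ (flipSign i v) t)).sqrt

/-- As `x² = 1`, the two factors multiply to `1 - κ²`, and `√(1 - κ²) ≥ 1 - κ²`. -/
theorem one_sub_sq_mul_sqrt_le {κ L L' x : ℝ} (h1 : κ ^ 2 ≤ 1) (hx : x ^ 2 = 1) :
    (1 - κ ^ 2) * √(L * L') ≤ √(L * (1 + κ * x) * (L' * (1 - κ * x))) := by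
  have e : L * (1 + κ * x) * (L' * (1 - κ * x)) = (1 - κ ^ 2) * (L * L') := by
    linear_combination (-(κ ^ 2 * (L * L'))) * hx
  rw [e, Real.sqrt_mul (sub_nonneg.2 h1)]
  refine mul_le_mul_of_nonneg_right ?_ (Real.sqrt_nonneg _)
  exact Real.le_sqrt_of_sq_le (by nlinarith [sq_nonneg κ])

theorem sqrt_mul_le_half_add {a b : ℝ} (ha : 0 ≤ a) (hb : 0 ≤ b) : √(a * b) ≤ (a + b) / 2 := by
  refine Real.sqrt_le_iff.2 ⟨by linarith, ?_⟩
  nlinarith [sq_nonneg (a - b)]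

/-- For a pair differing at `i ≠ j` both likelihoods gain the same factor, which averages to `1`
over a fair coin: nothing is lost. Only pairs differing at `j` lose, and their loss is at most `κ²
√(L L') ≤ κ² (L + L') / 2`. Summed over `v` this is `κ² ∑ L`, independent of `j` and hence of `p`.
-/
theorem affinity_le_sum_snoc {s κ : ℝ} (hs : s ≠ 0) (h0 : 0 ≤ κ) (h1 : κ ≤ 1) {t : ℕ}
    (h : Hist d t) {p : Fin d → ℝ} (hp : p ∈ stdSimplex ℝ (Fin d)) :
    affinity s κ h ≤ ∑ j, p j *
        (1 / 2 * affinity s κ (Fin.snoc (α := fun _ => Vec d) h (EuclideanSpace.single j s)) +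
          1 / 2 * affinity s κ
            (Fin.snoc (α := fun _ => Vec d) h (EuclideanSpace.single j (-s)))) +
      κ ^ 2 * ∑ v : Fin d → ℤˣ, likelihood s κ v h := by
  have hκ : κ ^ 2 ≤ 1 := pow_le_one₀ h0 h1
  have hterm : ∀ (v : Fin d → ℤˣ) (i j : Fin d),
      √(likelihood s κ v h * likelihood s κ (flipSign i v) h) -
        (if j = i then κ ^ 2 * ((likelihood s κ v h + likelihood s κ (flipSign i v) h) / 2)
          else 0) ≤
      1 / 2 * √(likelihood s κ v h * (1 + κ * signVec v j) *
          (likelihood s κ (flipSign i v) h * (1 + κ * signVec (flipSign i v) j))) +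
        1 / 2 * √(likelihood s κ v h * (1 - κ * signVec v j) *
          (likelihood s κ (flipSign i v) h * (1 - κ * signVec (flipSign i v) j))) := by
    intro v i j
    have hL := likelihood_nonneg s κ v h
    have hL' := likelihood_nonneg s κ (flipSign i v) h
    split_ifs with hij
    · subst hij
      have g1 := one_sub_sq_mul_sqrt_le (L := likelihood s κ v h)
        (L' := likelihood s κ (flipSign j v) h) hκ (signVec_sq v j)
      have g2 := one_sub_sq_mul_sqrt_le (L := likelihood s κ v h)
        (L' := likelihood s κ (flipSign j v) h) (x := -signVec v j) hκ (by simp [signVec_sq])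
      simp only [mul_neg, sub_neg_eq_add, ← sub_eq_add_neg] at g1 g2
      simp only [signVec_flipSign_self, mul_neg, sub_neg_eq_add, ← sub_eq_add_neg]
      have g3 := mul_le_mul_of_nonneg_left (sqrt_mul_le_half_add hL hL') (sq_nonneg κ)
      linarith
    · rw [signVec_flipSign_of_ne hij]
      have hx : 0 ≤ 1 + κ * signVec v j ∧ 0 ≤ 1 - κ * signVec v j := by
        rcases signVec_eq_or v j with e | e <;> rw [e] <;> constructor <;> linarith
      have hLL := mul_nonneg hL hL'
      rw [mul_mul_mul_comm, Real.sqrt_mul hLL, Real.sqrt_mul_self hx.1,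
        mul_mul_mul_comm, Real.sqrt_mul hLL, Real.sqrt_mul_self hx.2]
      linarith
  have hflip : ∀ i : Fin d, ∑ v : Fin d → ℤˣ,
      (likelihood s κ v h + likelihood s κ (flipSign i v) h) / 2 =
        ∑ v : Fin d → ℤˣ, likelihood s κ v h := fun i => by
    rw [← Finset.sum_div, Finset.sum_add_distrib,
      (flipSign i).sum_comp fun v => likelihood s κ v h]
    ring
  have hj : ∀ j : Fin d, affinity s κ h - κ ^ 2 * ∑ v : Fin d → ℤˣ, likelihood s κ v h ≤
      1 / 2 * affinity s κ (Fin.snoc (α := fun _ => Vec d) h (EuclideanSpace.single j s)) +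
        1 / 2 * affinity s κ
          (Fin.snoc (α := fun _ => Vec d) h (EuclideanSpace.single j (-s))) := fun j => by
    have hsum := Finset.sum_le_sum fun (v : Fin d → ℤˣ) (_ : v ∈ Finset.univ) =>
      Finset.sum_le_sum fun (i : Fin d) (_ : i ∈ Finset.univ) => hterm v i j
    simp only [Finset.sum_sub_distrib, Finset.sum_add_distrib, ← Finset.mul_sum,
      Finset.sum_ite_eq, Finset.mem_univ, if_true, hflip] at hsum
    unfold affinity
    simp only [(likelihood_snoc_single hs h0 h1 _ h j).1,
      (likelihood_snoc_single hs h0 h1 _ h j).2]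
    exact hsum
  have hfin := Finset.sum_le_sum fun (j : Fin d) (_ : j ∈ Finset.univ) =>
    mul_le_mul_of_nonneg_left (hj j) (hp.1 j)
  rw [← Finset.sum_mul, hp.2, one_mul] at hfin
  linarith

/-- All likelihoods start at `1`, and each keeps integral `1` under the reference law, so every
round costs at most `κ²` per sign vector. The loss stands on the right to avoid truncated
subtraction. -/
theorem le_lintegral_affinity (π : Algorithm X T)
    (S : ChannelStrategy (obliviousChannels d) π.Seed) {s κ : ℝ} (hs : s ≠ 0) (h0 : 0 ≤ κ)
    (h1 : κ ≤ 1) (ω : π.Seed) (t : ℕ) :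
    (Fintype.card (Fin d → ℤˣ) * d : ℝ≥0∞) ≤
      ∫⁻ h, ENNReal.ofReal (affinity s κ h) ∂(transcript (signOracle X s 0 1) π S t ω) +
        t * (ENNReal.ofReal (κ ^ 2) * Fintype.card (Fin d → ℤˣ)) := by
  have := isMarkovKernel_signOracle (X := X) s le_rfl zero_le_one (1 : Fin d → ℤˣ)
  induction t with
  | zero =>
    rw [lintegral_transcript_zero _ _ _ _ (measurable_affinity s κ 0).ennreal_ofReal]
    have e : affinity s κ (d := d) Fin.elim0 = ((Fintype.card (Fin d → ℤˣ) * d : ℕ) : ℝ) := by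
      simp [affinity, likelihood]
    rw [e, ENNReal.ofReal_natCast]
    simp
  | succ t ih =>
    have hm := (measurable_affinity (d := d) s κ (t + 1)).ennreal_ofReal
    rw [lintegral_transcript_succ _ _ _ _ _ hm]
    refine ih.trans ?_
    have hle : ∀ h : Hist d t, ENNReal.ofReal (affinity s κ h) ≤
        ∫⁻ y, ENNReal.ofReal (affinity s κ (Fin.snoc (α := fun _ => Vec d) h y))
          ∂(stepKernel (signOracle X s 0 1) π S t (ω, h)) +
        ENNReal.ofReal (κ ^ 2) *
          ∑ v : Fin d → ℤˣ, ENNReal.ofReal (likelihood s κ v h) := fun h => by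
      obtain ⟨p, hp, hstep⟩ := exists_lintegral_stepKernel_signOracle π S t (ω, h) s
      rw [hstep le_rfl zero_le_one 1
          (F := fun y => ENNReal.ofReal (affinity s κ (Fin.snoc (α := fun _ => Vec d) h y)))
          (hm.comp ((measurable_snoc t).comp measurable_prodMk_left)),
        ← ENNReal.ofReal_sum_of_nonneg fun v _ => likelihood_nonneg s κ v h,
        ← ENNReal.ofReal_mul (sq_nonneg κ)]
      refine (ENNReal.ofReal_le_ofReal (affinity_le_sum_snoc hs h0 h1 h hp)).trans ?_
      refine ENNReal.ofReal_add_le.trans (add_le_add_left ?_ _)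
      rw [ENNReal.ofReal_sum_of_nonneg fun j _ => mul_nonneg (hp.1 j) (add_nonneg
        (mul_nonneg (by norm_num) (affinity_nonneg _ _ _))
        (mul_nonneg (by norm_num) (affinity_nonneg _ _ _)))]
      refine Finset.sum_le_sum fun j _ => ?_
      rw [ENNReal.ofReal_mul (hp.1 j)]
      gcongr
      refine ENNReal.ofReal_add_le.trans ?_
      rw [ENNReal.ofReal_mul (by norm_num), ENNReal.ofReal_mul (by norm_num)]
      simp
    have hint := lintegral_mono (μ := transcript (signOracle X s 0 1) π S t ω) hle
    have hmL : ∀ v : Fin d → ℤˣ, Measurable fun h : Hist d t =>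
        ENNReal.ofReal (likelihood s κ v h) := fun v => (measurable_likelihood s κ v t).ennreal_ofReal
    rw [lintegral_add_right _ ((Finset.measurable_fun_sum _ fun v _ => hmL v).const_mul _),
      lintegral_const_mul' _ _ ENNReal.ofReal_ne_top,
      lintegral_finsetSum _ fun v _ => hmL v] at hint
    simp only [lintegral_likelihood π S hs h0 h1, Finset.sum_const, Finset.card_univ,
      nsmul_eq_mul, mul_one] at hint
    refine (add_le_add_left hint _).trans (le_of_eq ?_)
    push_cast
    ring

end Likelihood

/-! ### From affinity to optimization error on the cube. -/

section LowerBound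

variable {d : ℕ} {X : Set (Vec d)} {T : ℕ}

/-- Writing `2b = (b + z) + (b - z)`, it suffices that `13/8 x² + 5/8 y² ≥ 2xy` and its mirror
image, which hold because `13 · 5 ≥ 64`. The best constant in place of `5/8` would be `(√5 - 1)/2`.
-/
theorem affinity_term_le {b z L L' : ℝ} (hz : |z| ≤ b) (hL : 0 ≤ L) (hL' : 0 ≤ L') :
    2 * b * (2 * √(L * L') - 5 / 8 * (L + L')) ≤ (b + z) * L + (b - z) * L' := by
  obtain ⟨h1, h2⟩ := abs_le.1 hz
  rw [Real.sqrt_mul hL]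
  have e1 := Real.sq_sqrt hL
  have e2 := Real.sq_sqrt hL'
  set x := √L
  set y := √L'
  rw [← e1, ← e2]
  have g1 : 0 ≤ (b + z) * (13 / 8 * x ^ 2 + 5 / 8 * y ^ 2 - 2 * (x * y)) :=
    mul_nonneg (by linarith) (by nlinarith [sq_nonneg (5 / 8 * y - x), sq_nonneg x])
  have g2 : 0 ≤ (b - z) * (5 / 8 * x ^ 2 + 13 / 8 * y ^ 2 - 2 * (x * y)) :=
    mul_nonneg (by linarith) (by nlinarith [sq_nonneg (5 / 8 * x - y), sq_nonneg y])
  linarith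

theorem two_mul_affinity_le (s κ : ℝ) {b : ℝ} {x : Vec d} (hx : ∀ i, |x i| ≤ b) {t : ℕ}
    (h : Hist d t) :
    2 * b * affinity s κ h ≤
      ∑ v : Fin d → ℤˣ, (∑ i, (b + signVec v i * x i)) * likelihood s κ v h +
        5 / 4 * b * d * ∑ v : Fin d → ℤˣ, likelihood s κ v h := by
  have hterm : ∀ (v : Fin d → ℤˣ) (i : Fin d),
      2 * b * (2 * √(likelihood s κ v h * likelihood s κ (flipSign i v) h) -
          5 / 8 * (likelihood s κ v h + likelihood s κ (flipSign i v) h)) ≤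
        (b + signVec v i * x i) * likelihood s κ v h +
          (b + signVec (flipSign i v) i * x i) * likelihood s κ (flipSign i v) h := fun v i => by
    rw [signVec_flipSign_self, neg_mul, ← sub_eq_add_neg]
    refine affinity_term_le ?_ (likelihood_nonneg _ _ _ _) (likelihood_nonneg _ _ _ _)
    rw [abs_mul, abs_signVec, one_mul]
    exact hx i
  have hsum := Finset.sum_le_sum fun (i : Fin d) (_ : i ∈ Finset.univ) =>
    Finset.sum_le_sum fun (v : Fin d → ℤˣ) (_ : v ∈ Finset.univ) => hterm v i
  -- Flipping a sign permutes the sign vectors, so each one is counted twice for every `i`; the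
  -- final bound is half of the summed one.
  have hflip : ∀ (i : Fin d) (F : (Fin d → ℤˣ) → ℝ), ∑ v, F (flipSign i v) = ∑ v, F v :=
    fun i F => (flipSign i).sum_comp F
  have hflip1 := fun i => hflip i fun v => likelihood s κ v h
  have hflip2 := fun i => hflip i fun v => (b + signVec v i * x i) * likelihood s κ v h
  simp only [← Finset.mul_sum, Finset.sum_sub_distrib, Finset.sum_add_distrib, hflip1,
    hflip2] at hsum
  simp only [Finset.sum_const, Finset.card_univ, Fintype.card_fin, nsmul_eq_mul] at hsum
  have e1 : ∑ i, ∑ v : Fin d → ℤˣ, √(likelihood s κ v h * likelihood s κ (flipSign i v) h) =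
      affinity s κ h := Finset.sum_comm
  have e2 : ∑ i, ∑ v : Fin d → ℤˣ, (b + signVec v i * x i) * likelihood s κ v h =
      ∑ v : Fin d → ℤˣ, (∑ i, (b + signVec v i * x i)) * likelihood s κ v h := by
    rw [Finset.sum_comm]
    simp only [Finset.sum_mul]
  rw [e1, e2] at hsum
  linarith

theorem sum_add_signVec_mul_nonneg {b : ℝ} {x : Vec d} (hx : ∀ i, |x i| ≤ b) (v : Fin d → ℤˣ) :
    0 ≤ ∑ i, (b + signVec v i * x i) :=
  Finset.sum_nonneg fun i _ => by
    have : |signVec v i * x i| ≤ b := by rw [abs_mul, abs_signVec, one_mul]; exact hx i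
    linarith [(abs_le.1 this).1]

theorem ofReal_le_sum_lintegral_transcript (π : Algorithm X T)
    (S : ChannelStrategy (obliviousChannels d) π.Seed) {s κ : ℝ} (hs : s ≠ 0) (h0 : 0 ≤ κ)
    (h1 : κ ≤ 1) (hκ : T * κ ^ 2 ≤ d / 16) (ω : π.Seed) {b : ℝ} (hb : 0 ≤ b)
    {x : Hist d T → Vec d} (hxm : Measurable x) (hx : ∀ h i, |x h i| ≤ b) :
    ENNReal.ofReal (5 / 8 * b * d * Fintype.card (Fin d → ℤˣ)) ≤
      ∑ v : Fin d → ℤˣ, ∫⁻ h, ENNReal.ofReal (∑ i, (b + signVec v i * x h i))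
        ∂(transcript (signOracle X s κ v) π S T ω) := by
  have := isMarkovKernel_signOracle (X := X) s le_rfl zero_le_one (1 : Fin d → ℤˣ)
  have hmF : ∀ v : Fin d → ℤˣ, Measurable fun h =>
      ENNReal.ofReal (∑ i, (b + signVec v i * x h i)) := fun v => by fun_prop
  have hmL : ∀ v : Fin d → ℤˣ, Measurable fun h : Hist d T =>
      ENNReal.ofReal (likelihood s κ v h) := fun v => (measurable_likelihood s κ v T).ennreal_ofReal
  simp_rw [fun v => lintegral_transcript_signOracle π S hs h0 h1 v ω T (hmF v)]
  rw [← lintegral_finsetSum (f := fun v h => ENNReal.ofReal (∑ i, (b + signVec v i * x h i)) *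
    ENNReal.ofReal (likelihood s κ v h)) _ fun v _ => (hmF v).mul (hmL v)]
  have hpt : ∀ h : Hist d T, ENNReal.ofReal (2 * b) * ENNReal.ofReal (affinity s κ h) ≤
      ∑ v : Fin d → ℤˣ, ENNReal.ofReal (∑ i, (b + signVec v i * x h i)) *
        ENNReal.ofReal (likelihood s κ v h) +
      ENNReal.ofReal (5 / 4 * b * d) *
        ∑ v : Fin d → ℤˣ, ENNReal.ofReal (likelihood s κ v h) := fun h => by
    have hF := sum_add_signVec_mul_nonneg (hx h)
    rw [← ENNReal.ofReal_mul (by positivity),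
      ← ENNReal.ofReal_sum_of_nonneg fun v _ => likelihood_nonneg s κ v h,
      ← ENNReal.ofReal_mul (by positivity)]
    simp_rw [fun v => (ENNReal.ofReal_mul (q := likelihood s κ v h) (hF v)).symm]
    rw [← ENNReal.ofReal_sum_of_nonneg
      fun v _ => mul_nonneg (hF v) (likelihood_nonneg s κ v h)]
    exact (ENNReal.ofReal_le_ofReal (two_mul_affinity_le s κ (hx h) h)).trans
      ENNReal.ofReal_add_le
  have hint := lintegral_mono (μ := transcript (signOracle X s 0 1) π S T ω) hpt
  rw [lintegral_add_right _ ((Finset.measurable_fun_sum _ fun v _ => hmL v).const_mul _),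
    lintegral_const_mul' _ _ ENNReal.ofReal_ne_top,
    lintegral_const_mul' _ _ ENNReal.ofReal_ne_top,
    lintegral_finsetSum _ fun v _ => hmL v] at hint
  simp only [lintegral_likelihood π S hs h0 h1, Finset.sum_const, Finset.card_univ,
    nsmul_eq_mul, mul_one] at hint
  have haff := mul_le_mul_right (le_lintegral_affinity π S hs h0 h1 ω T) (ENNReal.ofReal (2 * b))
  rw [mul_add] at haff
  have htot := haff.trans (add_le_add_left hint _)
  set N := Fintype.card (Fin d → ℤˣ)
  have c1 : ENNReal.ofReal (2 * b) * ((N : ℝ≥0∞) * d) = ENNReal.ofReal (2 * b * (N * d)) := by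
    rw [ENNReal.ofReal_mul (p := 2 * b) (by positivity),
      ENNReal.ofReal_mul (p := (N : ℝ)) (by positivity), ENNReal.ofReal_natCast,
      ENNReal.ofReal_natCast]
  have c2 : ENNReal.ofReal (5 / 4 * b * d) * (N : ℝ≥0∞) = ENNReal.ofReal (5 / 4 * b * d * N) := by
    rw [ENNReal.ofReal_mul (p := 5 / 4 * b * d) (by positivity), ENNReal.ofReal_natCast]
  have c3 : ENNReal.ofReal (2 * b) * ((T : ℝ≥0∞) * (ENNReal.ofReal (κ ^ 2) * N)) =
      ENNReal.ofReal (2 * b * (T * (κ ^ 2 * N))) := by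
    rw [ENNReal.ofReal_mul (p := 2 * b) (by positivity),
      ENNReal.ofReal_mul (p := (T : ℝ)) (by positivity), ENNReal.ofReal_mul (sq_nonneg κ),
      ENNReal.ofReal_natCast, ENNReal.ofReal_natCast]
  rw [c1, c2, c3, add_assoc, ← ENNReal.ofReal_add (by positivity) (by positivity),
    ← tsub_le_iff_right, ← ENNReal.ofReal_sub _ (by positivity)] at htot
  refine le_trans (ENNReal.ofReal_le_ofReal ?_) htot
  -- With `N` sign vectors, `2b · (15/16) d N - (5/4) b d N = (5/8) b d N`.
  have := mul_le_mul_of_nonneg_left hκ (show 0 ≤ 2 * b * N by positivity)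
  linarith

/-- The cube `[-b, b]^d`. -/
def cube (d : ℕ) (b : ℝ) : Set (Vec d) := {x | ∀ i, |x i| ≤ b}

theorem cube_mem_domains {b D : ℝ} (hb : 0 ≤ b) (hD : 0 ≤ D) (hbD : 4 * b ^ 2 * d ≤ D ^ 2) :
    cube d b ∈ Domains d D := by
  have hnorm : ∀ x ∈ cube d b, ∀ y ∈ cube d b, ‖x - y‖ ≤ D := fun x hx y hy => by
    refine le_of_sq_le_sq ?_ hD
    rw [EuclideanSpace.real_norm_sq_eq]
    calc ∑ i, (x - y) i ^ 2 ≤ ∑ _i : Fin d, (2 * b) ^ 2 := by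
          refine Finset.sum_le_sum fun i _ => sq_le_sq' ?_ ?_ <;>
            simp only [PiLp.sub_apply] <;>
            linarith [(abs_le.1 (hx i)).1, (abs_le.1 (hx i)).2, (abs_le.1 (hy i)).1,
              (abs_le.1 (hy i)).2]
      _ = 4 * b ^ 2 * d := by simp; ring
      _ ≤ D ^ 2 := hbD
  have h0 : (0 : Vec d) ∈ cube d b := fun i => by simpa using hb
  refine ⟨⟨0, h0⟩, ?_, ?_, hnorm⟩
  · have : cube d b = ⋂ i : Fin d, (EuclideanSpace.proj (𝕜 := ℝ) i) ⁻¹' Set.Icc (-b) b := by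
      ext x; simp [cube, abs_le]
    rw [this]
    exact convex_iInter fun i => (convex_Icc _ _).is_linear_preimage
      (EuclideanSpace.proj (𝕜 := ℝ) i).isLinear
  · refine Metric.isCompact_of_isClosed_isBounded ?_ ?_
    · simp only [cube, Set.ofPred_forall]
      exact isClosed_iInter fun i => isClosed_le (by fun_prop) continuous_const
    · exact Metric.isBounded_iff.2 ⟨D, fun x hx y hy => by
        rw [dist_eq_norm]; exact hnorm x hx y hy⟩

theorem iInf_inner_signVec_le {b a : ℝ} (hb : 0 ≤ b) (ha : 0 ≤ a) (v : Fin d → ℤˣ) :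
    ⨅ x : cube d b, ⟪a • signVec v, (x : Vec d)⟫ ≤ -(a * (d * b)) := by
  have hmem : -(b • signVec v) ∈ cube d b := fun i => by
    simp [abs_mul, abs_signVec, abs_of_nonneg hb]
  -- A real infimum over a family unbounded below has a default value, so boundedness must be
  -- checked before evaluating at the minimizing corner.
  have hbdd : BddBelow (Set.range fun x : cube d b => ⟪a • signVec v, (x : Vec d)⟫) := by
    refine ⟨-(a * (d * b)), ?_⟩
    rintro _ ⟨x, rfl⟩
    have h := mul_nonneg ha (sum_add_signVec_mul_nonneg x.2 v)
    rw [Finset.sum_add_distrib] at h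
    simp only [Finset.sum_const, Finset.card_univ, Fintype.card_fin, nsmul_eq_mul] at h
    dsimp only
    rw [real_inner_smul_left, PiLp.inner_apply]
    simp only [RCLike.inner_apply, conj_trivial]
    simp_rw [mul_comm (signVec v _)] at h
    linarith
  refine (ciInf_le hbdd ⟨_, hmem⟩).trans (le_of_eq ?_)
  rw [inner_neg_right, real_inner_smul_left, real_inner_smul_right, real_inner_self_eq_norm_sq,
    norm_signVec_sq]
  ring

theorem le_worstError_cube {s κ b B : ℝ} (hs : 0 < s) (h0 : 0 ≤ κ) (h1 : κ ≤ 1) (hb : 0 ≤ b)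
    (hsB : s ^ 2 * d ≤ B ^ 2) (hκ : T * κ ^ 2 ≤ d / 16) (hX : Convex ℝ (cube d b))
    (π : Algorithm (cube d b) T) (S : ChannelStrategy (obliviousChannels d) π.Seed) :
    ENNReal.ofReal (5 / 8 * b * d * (κ * s)) ≤ worstError (ConvexLipschitz (cube d b) B) π S := by
  have hκs : 0 ≤ κ * s := by positivity
  let G : (Fin d → ℤˣ) → π.Seed × Hist d T → ℝ≥0∞ := fun v z =>
    ENNReal.ofReal (∑ i, (b + signVec v i * (π.output z : Vec d) i))
  have hout : Measurable fun z => (π.output z : Vec d) :=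
    measurable_subtype_coe.comp π.measurable_output
  have hG : ∀ v, Measurable (G v) := fun v => by
    simp only [G]
    fun_prop
  have herr : ∀ v : Fin d → ℤˣ, ENNReal.ofReal (κ * s) * ∫⁻ ω, ∫⁻ h, G v (ω, h)
      ∂(transcript (signOracle (cube d b) s κ v) π S T ω) ∂π.seedLaw ≤
        worstError (ConvexLipschitz (cube d b) B) π S := fun v => by
    have := isMarkovKernel_signOracle (X := cube d b) s h0 h1 v
    refine le_trans ?_ (le_iSup₂ (f := fun fO _ => error fO.1 fO.2 π S) _
      (signOracle_mem_convexLipschitz hX h0 h1 hsB v))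
    rw [← Measure.lintegral_compProd (hG v), ← lintegral_const_mul' _ _ ENNReal.ofReal_ne_top]
    refine lintegral_mono fun z => ?_
    simp only [G]
    rw [← ENNReal.ofReal_mul hκs]
    refine ENNReal.ofReal_le_ofReal ?_
    -- The gap at `x` is at least `κ s ∑ (b + u_i x_i)`, the quantity controlled by the affinity.
    have h := iInf_inner_signVec_le hb hκs v
    refine le_trans (le_of_eq ?_) (sub_le_sub_left h _)
    rw [Finset.sum_add_distrib, real_inner_smul_left, PiLp.inner_apply]
    simp only [Finset.sum_const, Finset.card_univ, Fintype.card_fin, nsmul_eq_mul,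
      RCLike.inner_apply, conj_trivial, mul_comm (signVec v _)]
    ring
  -- The worst error dominates the average over the sign vectors.
  have hsum := Finset.sum_le_card_nsmul Finset.univ _ _ fun v _ => herr v
  have hmeas : ∀ v, Measurable fun ω => ∫⁻ h, G v (ω, h)
      ∂(transcript (signOracle (cube d b) s κ v) π S T ω) := fun v => by
    have := isMarkovKernel_signOracle (X := cube d b) s h0 h1 v
    exact (hG v).lintegral_kernel_prod_right'
  rw [← Finset.mul_sum, ← lintegral_finsetSum _ fun v _ => hmeas v, Finset.card_univ,
    nsmul_eq_mul] at hsum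
  set N := Fintype.card (Fin d → ℤˣ)
  have hN : N ≠ 0 := Fintype.card_ne_zero
  have hlow : ENNReal.ofReal (5 / 8 * b * d * N) ≤ ∫⁻ ω, ∑ v : Fin d → ℤˣ, ∫⁻ h, G v (ω, h)
      ∂(transcript (signOracle (cube d b) s κ v) π S T ω) ∂π.seedLaw := by
    calc ENNReal.ofReal (5 / 8 * b * d * N)
        = ∫⁻ _, ENNReal.ofReal (5 / 8 * b * d * N) ∂π.seedLaw := by simp
      _ ≤ _ := lintegral_mono fun ω => ofReal_le_sum_lintegral_transcript π S hs.ne' h0 h1 hκ ω hb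
          (hout.comp measurable_prodMk_left) fun h i => (π.output (ω, h)).2 i
  have hfin := (mul_le_mul_right hlow (ENNReal.ofReal (κ * s))).trans hsum
  have e : ENNReal.ofReal (κ * s) * ENNReal.ofReal (5 / 8 * b * d * N) =
      (N : ℝ≥0∞) * ENNReal.ofReal (5 / 8 * b * d * (κ * s)) := by
    rw [← ENNReal.ofReal_natCast, ← ENNReal.ofReal_mul hκs, ← ENNReal.ofReal_mul (by positivity)]
    congr 1
    ring
  rw [e] at hfin
  exact (ENNReal.mul_le_mul_iff_right (by exact_mod_cast hN) (ENNReal.natCast_ne_top N)).1 hfin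

end LowerBound

end InfoOpt

/-! ### Choice of the parameters. -/

open InfoOpt
theorem theoremt (d T : ℕ) (hd : 1 ≤ d) (hT : (d : ℝ) / 4 ≤ (T : ℝ))
    (D B : ℝ) (hD : 0 < D) (hB : 0 < B) :
    -- the lower bound for all algorithms and all adaptive channel selection strategies
    ENNReal.ofReal (1 / 72 * (√(d : ℝ) * D * B / √(T : ℝ))) ≤
        (⨆ X ∈ Domains d D,
          minmaxError X (ConvexLipschitz X B) T (obliviousChannels d)) ∧
    -- uniform random coordinate descent attains it up to the factor 72, on every domain
    ∀ X ∈ Domains d D, ∀ x₀ : X, ∃ π : Algorithm X T,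
      IsCoordinateDescent π x₀ (√(d : ℝ) * D / (B * √(T : ℝ))) ∧
      worstError (ConvexLipschitz X B) π (ChannelStrategy.const (uniformSampling_mem hd)) ≤
        ENNReal.ofReal (√(d : ℝ) * D * B / √(T : ℝ)) := by
  have hd0 : (0 : ℝ) < d := by exact_mod_cast hd
  have hT0 : (0 : ℝ) < T := by linarith
  have hTN : 0 < T := by exact_mod_cast hT0
  have hsd : 0 < √(d : ℝ) := Real.sqrt_pos.2 hd0
  have hsT : 0 < √(T : ℝ) := Real.sqrt_pos.2 hT0
  have esd : √(d : ℝ) ^ 2 = d := Real.sq_sqrt hd0.le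
  have esT : √(T : ℝ) ^ 2 = T := Real.sq_sqrt hT0.le
  constructor
  · have hb : 0 ≤ D / (2 * √(d : ℝ)) := by positivity
    have hdom : cube d (D / (2 * √(d : ℝ))) ∈ Domains d D := by
      refine cube_mem_domains hb hD.le (le_of_eq ?_)
      rw [div_pow, mul_pow, esd]
      field_simp
      norm_num
    refine le_trans ?_ (le_iSup₂ (f := fun X _ =>
      minmaxError X (ConvexLipschitz X B) T (obliviousChannels d)) _ hdom)
    refine le_iInf fun π => le_iInf fun S => ?_
    -- The bias must not exceed `1`; this needs only `d ≤ 16 T`.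
    have h1 : 1 / 4 * (√(d : ℝ) / √(T : ℝ)) ≤ 1 := by
      have : √(d : ℝ) / √(T : ℝ) ≤ 4 := by
        rw [div_le_iff₀ hsT]
        nlinarith
      linarith
    -- Each parameter is extremal: `b` gives diameter exactly `D`, `s` gives oracle norm exactly
    -- `B`, and `κ` gives `T κ² = d / 16`. The resulting constant `5/64` exceeds `1/72`.
    refine le_trans (ENNReal.ofReal_le_ofReal ?_) (le_worstError_cube (s := B / √(d : ℝ))
      (κ := 1 / 4 * (√(d : ℝ) / √(T : ℝ))) (B := B) (by positivity) (by positivity) h1 hb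
      (le_of_eq ?_) (le_of_eq ?_) hdom.2.1 π S)
    · have e : 5 / 8 * (D / (2 * √(d : ℝ))) * d * (1 / 4 * (√(d : ℝ) / √(T : ℝ)) *
          (B / √(d : ℝ))) = 5 / 64 * (√(d : ℝ) * D * B / √(T : ℝ)) := by
        nth_rewrite 2 [← esd]
        field_simp
        norm_num
      rw [e]
      have : 0 ≤ √(d : ℝ) * D * B / √(T : ℝ) := by positivity
      linarith
    · rw [div_pow, esd]
      field_simp
    · rw [mul_pow, div_pow √(d : ℝ), esd, esT]
      field_simp
      norm_num
  · rintro X ⟨-, hconv, hcomp, hdiam⟩ x₀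
    obtain ⟨π, hπ⟩ := exists_isCoordinateDescent hconv hcomp hTN x₀ (√(d : ℝ) * D / (B * √(T : ℝ)))
    refine ⟨π, hπ, (worstError_coordinateDescent_le hd hTN hconv hcomp hdiam hB.le
      (by positivity) hπ).trans (ENNReal.ofReal_le_ofReal (le_of_eq ?_))⟩
    -- This step size balances the two error terms, each being half of the claimed bound.
    have e : (d : ℝ) * D ^ 2 / (2 * (√(d : ℝ) * D / (B * √(T : ℝ))) * T) =
        √(d : ℝ) * D * B / √(T : ℝ) / 2 := by
      nth_rewrite 1 [← esd]
      nth_rewrite 2 [← esT]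
      field_simp
    rw [e]
    field_simp
    ring
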